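/- Let $(T,\mathcal F,\mu)$ be a $\sigma$-finite non-atomic measure space (every $A\in\mathcal F$ with $\mu(A)>0$ contains some $B\in\mathcal F$ with $0<\mu(B)<\mu(A)$), $E$ a real Banach space, $p\in[1,+\infty[$, and let $X\subseteq L^p(T,E)$ be decomposable, i.e. $\chi_A u+(1-\chi_A)v\in X$ for all $u,v\in X$ and $A\in\mathcal F$, where $\chi_A$ is the characteristic function of $A$. Let $[a,b]$ be a compact real interval and $\gamma:[a,b]\to\mathbf R$ a convex (resp. concave) and continuous function. Let $\varphi,\psi,\omega:T\times E\to\mathbf R$ be Carathéodory functions (measurable in $t\in T$ for each fixed $x\in E$, continuous in $x\in E$ for each fixed $t\in T$) such that, for some $M\in L^1(T)$ and $k\in\mathbf R$, $$\max\{|\varphi(t,x)|,|\psi(t,x)|,|\omega(t,x)|\}\le M(t)+k\|x\|^p\qquad\text{for all }(t,x)\in T\times E,$$ and $$\gamma(a)\int_T\psi(t,u(t))\,d\mu+a\int_T\omega(t,u(t))\,d\mu\ \ne\ \gamma(b)\int_T\psi(t,u(t))\,d\mu+b\int_T\omega(t,u(t))\,d\mu$$ for all $u\in X$ such that $\int_T\psi(t,u(t))\,d\mu>0$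 (resp. $\int_T\psi(t,u(t))\,d\mu<0$). Then, with suprema and infima taken in $[-\infty,+\infty]$, $$\sup_{\lambda\in[a,b]}\inf_{u\in X}\int_T\bigl(\varphi(t,u(t))+\gamma(\lambda)\psi(t,u(t))+\lambda\,\omega(t,u(t))\bigr)\,d\mu=\inf_{u\in X}\sup_{\lambda\in[a,b]}\int_T\bigl(\varphi(t,u(t))+\gamma(\lambda)\psi(t,u(t))+\lambda\,\omega(t,u(t))\bigr)\,d\mu .$$ -/

import Mathlib

open MeasureTheory Set
open scoped ENNReal

/-- A measure is non-atomic if every measurable set of positive measure contains a measurable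
subset of positive and strictly smaller measure. (This is not `MeasureTheory.NoAtoms`, which only
says that singletons are null.) -/
def NonAtomic {T : Type*} [MeasurableSpace T] (μ : Measure T) : Prop :=
  ∀ A : Set T, MeasurableSet A → 0 < μ A →
    ∃ B : Set T, B ⊆ A ∧ MeasurableSet B ∧ 0 < μ B ∧ μ B < μ A

/-- `D ⊆ L^p(T,E)` is decomposable if `χ_A u + (1 - χ_A) v` (as an equivalence class) belongs
to `D` for all `u, v ∈ D` and all measurable `A`. -/
def Decomposable {T E : Type*} [MeasurableSpace T] [NormedAddCommGroup E] [NormedSpace ℝ E]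
    {p : ℝ≥0∞} {μ : Measure T} (D : Set (Lp E p μ)) : Prop :=
  ∀ u ∈ D, ∀ v ∈ D, ∀ A : Set T, MeasurableSet A →
    ∃ w ∈ D, (w : T → E) =ᵐ[μ] fun t =>
      A.indicator (fun _ => (1 : ℝ)) t • u t + (1 - A.indicator (fun _ => (1 : ℝ)) t) • v t

/-- A Carathéodory function: measurable in the first variable, continuous in the second. -/
def Caratheodory {T E : Type*} [MeasurableSpace T] [TopologicalSpace E]
    (φ : T → E → ℝ) : Prop :=
  (∀ x : E, Measurable fun t => φ t x) ∧ ∀ t : T, Continuous (φ t)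

/-!
The pairing depends on `u` only through the point `(∫ φ, ∫ ψ, ∫ ω)` of `ℝ³`, and by Lyapunov's
theorem these points fill a convex set `K` as `u` runs over `X`. Let `γ` be convex; the concave case
follows by passing to `(-γ, -ψ)`. If `λ` is allowed to run over the convex hull of the graph of `γ`
instead of the graph, then the pairing becomes affine in both variables and Sion's minimax theorem
applies. It remains to see that each point of the hull is dominated, uniformly on `K`, by a point of
the graph. The condition at `a` and `b` says that the direction of the chord of `γ` does not
annihilate the points of `K` with `∫ ψ > 0`, so by separation there is a slope `κ`, comparable with
that of the chord, for which `κ ∫ ψ + ∫ ω` has constant sign on `K`, unless `∫ ψ ≤ 0` throughout.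
Sliding the given point along a line of slope `κ` then only improves the pairing, and the line meets
the graph, since the point lies between the graph and the chord.

Lyapunov's theorem is obtained by adding one density at a time to a family all of whose integrals
can be halved simultaneously: iterated halving yields a chain of sets along which the old integrals
grow linearly, and the intermediate value theorem selects a window of length `1 / 2` in the chain
that halves the new integral as well.
-/

open Filter Topology

/-- The Brezis–Browder principle: pass repeatedly to a larger element that realizes at least half of
the remaining possible growth of `F`. -/
theorem exists_forall_ge_eq_of_monotone {Q : Type*} [Preorder Q] [Nonempty Q] {F : Q → ℝ}
    (hF : Monotone F) (hbdd : BddAbove (range F))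
    (hseq : ∀ x : ℕ → Q, Monotone x → BddAbove (range x)) :
    ∃ x, ∀ y, x ≤ y → F y = F x := by
  have hbdd' (x : Q) : BddAbove (F '' Ici x) := hbdd.mono (image_subset_range F _)
  have hstep (x : Q) : ∃ y, x ≤ y ∧ (F x + sSup (F '' Ici x)) / 2 ≤ F y := by
    have hx : F x ∈ F '' Ici x := mem_image_of_mem F self_mem_Ici
    rcases (le_csSup (hbdd' x) hx).eq_or_lt with h | h
    · exact ⟨x, le_rfl, by linarith⟩
    · obtain ⟨_, ⟨y, hxy, rfl⟩, hy⟩ := exists_lt_of_lt_csSup ⟨_, hx⟩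
        (show (F x + sSup (F '' Ici x)) / 2 < sSup (F '' Ici x) by linarith)
      exact ⟨y, hxy, hy.le⟩
  choose next hle_next hnext using hstep
  let x (n : ℕ) : Q := next^[n] (Classical.arbitrary Q)
  have hx_succ (n : ℕ) : x (n + 1) = next (x n) := Function.iterate_succ_apply' ..
  have hx : Monotone x := monotone_nat_of_le_succ fun n => hx_succ n ▸ hle_next (x n)
  obtain ⟨u, hu⟩ := hseq x hx
  have hxu (n : ℕ) : x n ≤ u := hu (mem_range_self n)
  obtain ⟨L, hL⟩ : ∃ L, Tendsto (F ∘ x) atTop (𝓝 L) :=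
    ⟨_, tendsto_atTop_ciSup (hF.comp hx) (hbdd.mono (range_comp_subset_range x F))⟩
  have hLu : L ≤ F u := le_of_tendsto' hL fun n => hF (hxu n)
  refine ⟨u, fun y huy => (hF huy).antisymm' ?_⟩
  have hgain (n : ℕ) : (F (x n) + F y) / 2 ≤ F (x (n + 1)) := by
    have := le_csSup (hbdd' (x n)) (mem_image_of_mem F ((hxu n).trans huy))
    rw [hx_succ]
    linarith [hnext (x n)]
  have := le_of_tendsto_of_tendsto' ((hL.add_const (F y)).div_const 2)
    (hL.comp (tendsto_add_atTop_nat 1)) hgain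
  linarith

section NonAtomic

variable {T : Type*} [MeasurableSpace T] {μ : Measure T} {S : Set T}

theorem NonAtomic.exists_subset_measureReal_le_half [IsFiniteMeasure μ] (hμ : NonAtomic μ)
    (hS : MeasurableSet S) (hS0 : 0 < μ.real S) :
    ∃ B ⊆ S, MeasurableSet B ∧ 0 < μ.real B ∧ μ.real B ≤ μ.real S / 2 := by
  obtain ⟨B, hBS, hB, hB0, hBlt⟩ := hμ S hS (ENNReal.toReal_pos_iff.1 hS0).1
  have hB0' : 0 < μ.real B := ENNReal.toReal_pos hB0.ne' (measure_ne_top _ _)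
  have hBlt' : μ.real B < μ.real S :=
    (ENNReal.toReal_lt_toReal (measure_ne_top _ _) (measure_ne_top _ _)).2 hBlt
  have hdiff : μ.real (S \ B) = μ.real S - μ.real B := measureReal_sdiff hBS hB
  rcases le_total (μ.real B) (μ.real S / 2) with h | h
  · exact ⟨B, hBS, hB, hB0', h⟩
  · exact ⟨S \ B, sdiff_subset, hS.diff hB, by linarith, by linarith⟩

theorem NonAtomic.exists_subset_measureReal_lt [IsFiniteMeasure μ] (hμ : NonAtomic μ)
    (hS : MeasurableSet S) (hS0 : 0 < μ.real S) {ε : ℝ} (hε : 0 < ε) :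
    ∃ B ⊆ S, MeasurableSet B ∧ 0 < μ.real B ∧ μ.real B < ε := by
  have hhalves (n : ℕ) : ∃ B ⊆ S, MeasurableSet B ∧ 0 < μ.real B ∧
      μ.real B ≤ μ.real S * (1 / 2) ^ n := by
    induction n with
    | zero => exact ⟨S, Subset.rfl, hS, hS0, by simp⟩
    | succ n ih =>
      obtain ⟨B, hBS, hB, hB0, hBn⟩ := ih
      obtain ⟨D, hDB, hD, hD0, hDle⟩ := hμ.exists_subset_measureReal_le_half hB hB0
      exact ⟨D, hDB.trans hBS, hD, hD0, by rw [pow_succ]; linarith⟩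
  have hlim : Tendsto (fun n : ℕ => μ.real S * (1 / 2 : ℝ) ^ n) atTop (𝓝 0) := by
    simpa using (tendsto_pow_atTop_nhds_zero_of_lt_one (r := (1 / 2 : ℝ)) (by norm_num)
      (by norm_num)).const_mul (μ.real S)
  obtain ⟨n, hn⟩ := (hlim.eventually_lt_const hε).exists
  obtain ⟨B, hBS, hB, hB0, hBn⟩ := hhalves n
  exact ⟨B, hBS, hB, hB0, hBn.trans_lt hn⟩

/-- Sierpiński's theorem: a maximal subset of measure at most `c` has measure exactly `c`. -/
theorem NonAtomic.exists_subset_measureReal_eq [IsFiniteMeasure μ] (hμ : NonAtomic μ)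
    (hS : MeasurableSet S) {c : ℝ} (hc : 0 ≤ c) (hcS : c ≤ μ.real S) :
    ∃ B ⊆ S, MeasurableSet B ∧ μ.real B = c := by
  let Q := {B : Set T // B ⊆ S ∧ MeasurableSet B ∧ μ.real B ≤ c}
  have : Nonempty Q := ⟨∅, empty_subset S, .empty, by simpa⟩
  have hseq (B : ℕ → Q) (hB : Monotone B) : BddAbove (range B) := by
    have hlim : Tendsto (fun n => μ.real (B n).1) atTop (𝓝 (μ.real (⋃ n, (B n).1))) :=
      (ENNReal.tendsto_toReal (measure_ne_top _ _)).comp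
        (tendsto_measure_iUnion_atTop fun m n hmn => hB hmn)
    refine ⟨⟨⋃ n, (B n).1, iUnion_subset fun n => (B n).2.1, .iUnion fun n => (B n).2.2.1,
      le_of_tendsto' hlim fun n => (B n).2.2.2⟩, ?_⟩
    rintro _ ⟨n, rfl⟩
    exact subset_iUnion (fun n => (B n).1) n
  obtain ⟨⟨U, hUS, hU, hUc⟩, hmax⟩ := exists_forall_ge_eq_of_monotone
    (F := fun B : Q => μ.real B.1) (fun _ _ hAB => measureReal_mono hAB)
    ⟨c, by rintro _ ⟨B, rfl⟩; exact B.2.2.2⟩ hseq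
  refine ⟨U, hUS, hU, hUc.antisymm (not_lt.1 fun hlt => ?_)⟩
  have hdiff : μ.real (S \ U) = μ.real S - μ.real U := measureReal_sdiff hUS hU
  obtain ⟨D, hDS, hD, hD0, hDlt⟩ := hμ.exists_subset_measureReal_lt (hS.diff hU)
    (by linarith) (sub_pos.2 hlt)
  have hUD : μ.real (U ∪ D) = μ.real U + μ.real D :=
    measureReal_union (disjoint_sdiff_right.mono_right hDS) hD
  have := hmax ⟨U ∪ D, union_subset hUS (hDS.trans sdiff_subset), hU.union hD,
    by linarith⟩ subset_union_left
  linarith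

theorem NonAtomic.withDensity (hμ : NonAtomic μ) {f : T → ℝ≥0∞} (hf : AEMeasurable f μ)
    [IsFiniteMeasure (μ.withDensity f)] : NonAtomic (μ.withDensity f) := by
  have hpos (B : Set T) : 0 < μ.withDensity f B ↔ 0 < μ ({t | f t ≠ 0} ∩ B) := by
    simp only [pos_iff_ne_zero, ne_eq, withDensity_apply_eq_zero' hf]
  intro A hA hA0
  have hnull : NullMeasurableSet ({t | f t ≠ 0} ∩ A) μ :=
    (hf.nullMeasurable (measurableSet_singleton 0).compl).inter hA.nullMeasurableSet
  obtain ⟨A', hA'sub, hA', hA'ae⟩ := hnull.exists_measurable_subset_ae_eq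
  obtain ⟨B, hBA', hB, hB0, hBlt⟩ := hμ A' hA' (by rwa [measure_congr hA'ae, ← hpos])
  have hBA : B ⊆ A := hBA'.trans (hA'sub.trans inter_subset_right)
  refine ⟨B, hBA, hB, ?_, ?_⟩
  · rwa [hpos, inter_eq_self_of_subset_right (hBA'.trans (hA'sub.trans inter_subset_left))]
  · have hrest : 0 < μ (A' \ B) := by
      rw [measure_sdiff hBA' hB.nullMeasurableSet hBlt.ne_top]
      exact tsub_pos_of_lt hBlt
    have : 0 < μ.withDensity f (A \ B) := (hpos _).2 (hrest.trans_le (measure_mono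
      fun t ht => ⟨(hA'sub ht.1).1, (hA'sub ht.1).2, ht.2⟩))
    rw [measure_sdiff hBA hB.nullMeasurableSet (measure_ne_top _ _)] at this
    exact tsub_pos_iff_lt.1 this

end NonAtomic

/-- The `k`-th term, for `0 ≤ k ≤ 2 ^ n`, of the `n`-th refinement of the chain `⊥ ≤ S`, in which
the step from `x` to `y` is refined by inserting `x ⊔ H (y \ x)`. It is used to turn a rule `H`
that selects one half of each element into a chain indexed by the dyadic rationals. -/
def dyadicChain {α : Type*} [GeneralizedBooleanAlgebra α] (H : α → α) (S : α) : ℕ → ℕ → α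
  | 0, k => if k = 0 then ⊥ else S
  | n + 1, k => if Even k then dyadicChain H S n (k / 2) else
      dyadicChain H S n (k / 2) ⊔ H (dyadicChain H S n (k / 2 + 1) \ dyadicChain H S n (k / 2))

section dyadicChain

variable {α : Type*} [GeneralizedBooleanAlgebra α] {H : α → α} (S : α) (n : ℕ)

theorem dyadicChain_succ_two_mul (k : ℕ) :
    dyadicChain H S (n + 1) (2 * k) = dyadicChain H S n k := by
  simp [dyadicChain]

theorem dyadicChain_succ_two_mul_add_one (k : ℕ) :
    dyadicChain H S (n + 1) (2 * k + 1) = dyadicChain H S n k ⊔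
      H (dyadicChain H S n (k + 1) \ dyadicChain H S n k) := by
  simp [dyadicChain, show (2 * k + 1) / 2 = k by omega]

theorem dyadicChain_mono (hH : ∀ x, H x ≤ x) : Monotone (dyadicChain H S n) := by
  induction n with
  | zero =>
    refine monotone_nat_of_le_succ fun k => ?_
    rcases eq_or_ne k 0 with rfl | hk <;> simp [dyadicChain, *]
  | succ n ih =>
    refine monotone_nat_of_le_succ fun k => ?_
    have hj (j : ℕ) : dyadicChain H S n j ≤ dyadicChain H S n (j + 1) := ih (Nat.le_succ j)
    obtain ⟨j, rfl | rfl⟩ := Nat.even_or_odd' k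
    · rw [dyadicChain_succ_two_mul_add_one, dyadicChain_succ_two_mul]
      exact le_sup_left
    · rw [dyadicChain_succ_two_mul_add_one, show 2 * j + 1 + 1 = 2 * (j + 1) by ring,
        dyadicChain_succ_two_mul]
      exact sup_le (hj j) ((hH _).trans sdiff_le)

theorem dyadicChain_le (hH : ∀ x, H x ≤ x) (k : ℕ) : dyadicChain H S n k ≤ S := by
  have htop : dyadicChain H S n (2 ^ n * (k + 1)) = S := by
    induction n with
    | zero => simp [dyadicChain]
    | succ n ih => rw [pow_succ', mul_assoc, dyadicChain_succ_two_mul, ih]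
  refine (dyadicChain_mono S n hH ?_).trans_eq htop
  nlinarith [Nat.one_le_two_pow (n := n)]

theorem monotone_dyadicChain_floor (hH : ∀ x, H x ≤ x) {t : ℝ} (ht : 0 ≤ t) :
    Monotone fun n : ℕ => dyadicChain H S n ⌊t * 2 ^ n⌋₊ := by
  refine monotone_nat_of_le_succ fun n => ?_
  rw [← dyadicChain_succ_two_mul]
  refine dyadicChain_mono S (n + 1) hH (Nat.le_floor ?_)
  rw [pow_succ]
  push_cast
  linarith [Nat.floor_le (mul_nonneg ht (pow_nonneg zero_le_two n))]

theorem map_dyadicChain (hH : ∀ x, H x ≤ x) {m : α → ℝ}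
    (hm : ∀ x y, Disjoint x y → m (x ⊔ y) = m x + m y) (hmH : ∀ x, m (H x) = m x / 2) {k : ℕ}
    (hk : k ≤ 2 ^ n) : m (dyadicChain H S n k) = k / 2 ^ n * m S := by
  induction n generalizing k with
  | zero =>
    have hbot : m ⊥ = 0 := by simpa using hm ⊥ ⊥ disjoint_bot_left
    have : k = 0 ∨ k = 1 := by rw [pow_zero] at hk; omega
    rcases this with rfl | rfl <;> simp [dyadicChain, hbot]
  | succ n ih =>
    rw [pow_succ] at hk
    obtain ⟨j, rfl | rfl⟩ := Nat.even_or_odd' k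
    · rw [dyadicChain_succ_two_mul, ih (by omega)]
      push_cast
      field
    · set x := dyadicChain H S n j with hx
      set y := dyadicChain H S n (j + 1) with hy
      have hxy : m (y \ x) = m y - m x := by
        rw [eq_sub_iff_add_eq', ← hm _ _ disjoint_sdiff_self_right,
          sup_sdiff_cancel_right (dyadicChain_mono S n hH (Nat.le_succ j))]
      rw [dyadicChain_succ_two_mul_add_one, hm _ _ (disjoint_sdiff_self_right.mono_right (hH _)),
        hmH, hxy, hx, hy, ih (by omega), ih (by omega)]
      push_cast
      field

end dyadicChain

/-- A family `𝓕` of real functions is halvable if every measurable set has a measurable subset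
carrying half of the integral of all members of `𝓕` simultaneously. This is the case `θ = 1 / 2` of
Lyapunov's theorem for the densities in `𝓕`, from which the general case follows. -/
def Halvable {T : Type*} [MeasurableSpace T] (μ : Measure T) (𝓕 : Set (T → ℝ)) : Prop :=
  ∀ S, MeasurableSet S → ∃ B ⊆ S, MeasurableSet B ∧
    ∀ f ∈ 𝓕, ∫ t in B, f t ∂μ = (∫ t in S, f t ∂μ) / 2

section Lyapunov

variable {T : Type*} [MeasurableSpace T] {μ : Measure T} {𝓕 : Set (T → ℝ)} {S : Set T}

theorem NonAtomic.halvable_singleton (hμ : NonAtomic μ) {w : T → ℝ} (hw : Integrable w μ)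
    (hw0 : 0 ≤ w) : Halvable μ {w} := by
  let ρ := μ.withDensity fun t => ENNReal.ofReal (w t)
  have : IsFiniteMeasure ρ := isFiniteMeasure_withDensity_ofReal hw.2
  have hρ : NonAtomic ρ := hμ.withDensity hw.1.aemeasurable.ennreal_ofReal
  have hreal {B : Set T} (hB : MeasurableSet B) : ρ.real B = ∫ t in B, w t ∂μ := by
    rw [measureReal_def, withDensity_apply _ hB,
      integral_eq_lintegral_of_nonneg_ae (ae_of_all _ hw0) hw.1.restrict]
  intro S hS
  obtain ⟨B, hBS, hB, hBc⟩ := hρ.exists_subset_measureReal_eq hS (c := ρ.real S / 2)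
    (by positivity) (half_le_self measureReal_nonneg)
  exact ⟨B, hBS, hB, by simpa only [mem_singleton_iff, forall_eq, ← hreal hB, ← hreal hS]⟩

theorem Halvable.exists_chain (h : Halvable μ 𝓕) (h𝓕 : ∀ f ∈ 𝓕, Integrable f μ)
    (hS : MeasurableSet S) :
    ∃ A : ℝ → Set T, Monotone A ∧ (∀ t, MeasurableSet (A t)) ∧ (∀ t, A t ⊆ S) ∧
      ∀ t ∈ Icc (0 : ℝ) 1, ∀ f ∈ 𝓕, ∫ x in A t, f x ∂μ = t * ∫ x in S, f x ∂μ := by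
  have hhalf (B : Subtype (MeasurableSet (α := T))) : ∃ C : Subtype (MeasurableSet (α := T)),
      C ≤ B ∧ ∀ f ∈ 𝓕, ∫ x in C, f x ∂μ = (∫ x in B, f x ∂μ) / 2 := by
    obtain ⟨C, hCB, hC, hint⟩ := h B B.2
    exact ⟨⟨C, hC⟩, hCB, hint⟩
  choose H hH hHint using hhalf
  let D := dyadicChain H ⟨S, hS⟩
  have hDint {f : T → ℝ} (hf : f ∈ 𝓕) {n k : ℕ} (hk : k ≤ 2 ^ n) :
      ∫ x in D n k, f x ∂μ = k / 2 ^ n * ∫ x in S, f x ∂μ :=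
    map_dyadicChain ⟨S, hS⟩ n hH (m := fun B => ∫ x in B, f x ∂μ)
      (fun B C hBC => setIntegral_union
        (disjoint_iff_inter_eq_empty.2 (congrArg Subtype.val hBC.eq_bot)) C.2
        (h𝓕 f hf).integrableOn (h𝓕 f hf).integrableOn) (fun B => hHint B f hf) hk
  have hDmono (n : ℕ) : Monotone (D n) := dyadicChain_mono _ n hH
  refine ⟨fun t => ⋃ n, D n ⌊t * 2 ^ n⌋₊, fun s t hst => ?_,
    fun t => .iUnion fun n => (D n _).2,
    fun t => iUnion_subset fun n => dyadicChain_le ⟨S, hS⟩ n hH _, fun t ht f hf => ?_⟩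
  · exact iUnion_mono fun n => hDmono n (Nat.floor_mono (by gcongr))
  have hlim := tendsto_setIntegral_of_monotone (fun n => (D n ⌊t * 2 ^ n⌋₊).2)
    (monotone_dyadicChain_floor _ hH ht.1)
    (h𝓕 f hf).integrableOn
  have hfloor (n : ℕ) : ⌊t * 2 ^ n⌋₊ ≤ 2 ^ n :=
    Nat.floor_le_of_le (by simpa using mul_le_of_le_one_left (pow_nonneg zero_le_two n) ht.2)
  simp only [hDint hf (hfloor _)] at hlim
  exact tendsto_nhds_unique hlim (((tendsto_nat_floor_mul_div_atTop ht.1).comp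
    (tendsto_pow_atTop_atTop_of_one_lt one_lt_two)).mul_const _)

theorem abs_setIntegral_sub_le {f g : T → ℝ} (hf : Integrable f μ) (hg : Integrable g μ)
    (hgf : ∀ t, |g t| ≤ f t) {A B : Set T} (hA : MeasurableSet A) (hAB : A ⊆ B) :
    |∫ t in B, g t ∂μ - ∫ t in A, g t ∂μ| ≤ ∫ t in B, f t ∂μ - ∫ t in A, f t ∂μ := by
  rw [← setIntegral_sdiff hA hg.integrableOn hAB, ← setIntegral_sdiff hA hf.integrableOn hAB]
  exact norm_integral_le_of_norm_le (f := g) hf.integrableOn (ae_of_all _ hgf)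

theorem continuousOn_setIntegral_of_abs_le {w g : T → ℝ} (hw : Integrable w μ)
    (hg : Integrable g μ) (hgw : ∀ t, |g t| ≤ w t) {A : ℝ → Set T} (hA : Monotone A)
    (hAm : ∀ t, MeasurableSet (A t)) {I : Set ℝ}
    (hAw : ContinuousOn (fun t => ∫ x in A t, w x ∂μ) I) :
    ContinuousOn (fun t => ∫ x in A t, g x ∂μ) I := by
  have hdist (s t : ℝ) : dist (∫ x in A s, g x ∂μ) (∫ x in A t, g x ∂μ) ≤
      dist (∫ x in A s, w x ∂μ) (∫ x in A t, w x ∂μ) := by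
    wlog hst : s ≤ t generalizing s t
    · simpa only [dist_comm] using this t s (le_of_not_ge hst)
    rw [dist_comm, dist_comm (∫ x in A s, w x ∂μ)]
    exact (abs_setIntegral_sub_le hw hg hgw (hAm s) (hA hst)).trans (le_abs_self _)
  intro t ht
  exact tendsto_iff_dist_tendsto_zero.2 (squeeze_zero (fun _ => dist_nonneg) (fun s => hdist s t)
    (tendsto_iff_dist_tendsto_zero.1 (hAw t ht)))

theorem exists_add_half_sub_eq_half {G : ℝ → ℝ} (hG : ContinuousOn G (Icc 0 1)) (hG0 : G 0 = 0) :
    ∃ t ∈ Icc (0 : ℝ) (1 / 2), G (t + 1 / 2) - G t = G 1 / 2 := by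
  have hΔ : ContinuousOn (fun t => G (t + 1 / 2) - G t) (Icc 0 (1 / 2)) :=
    (hG.comp (by fun_prop) fun t ht => ⟨by linarith [ht.1], by linarith [ht.2]⟩).sub
      (hG.mono (Icc_subset_Icc le_rfl (by norm_num)))
  have hmem : G 1 / 2 ∈ uIcc (G (0 + 1 / 2) - G 0) (G (1 / 2 + 1 / 2) - G (1 / 2)) := by
    rw [mem_uIcc, zero_add, add_halves, hG0]
    grind
  rw [← uIcc_of_le one_half_pos.le] at hΔ ⊢
  exact intermediate_value_uIcc hΔ hmem

theorem Halvable.insert (h : Halvable μ 𝓕) (h𝓕 : ∀ f ∈ 𝓕, Integrable f μ) {w g : T → ℝ}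
    (hw : w ∈ 𝓕) (hg : Integrable g μ) (hgw : ∀ t, |g t| ≤ w t) : Halvable μ (insert g 𝓕) := by
  intro S hS
  obtain ⟨A, hA, hAm, hAS, hint⟩ := h.exists_chain h𝓕 hS
  have hgdom {B C : Set T} (hB : MeasurableSet B) (hBC : B ⊆ C) :=
    abs_setIntegral_sub_le (h𝓕 w hw) hg hgw hB hBC
  have hG : ContinuousOn (fun t => ∫ x in A t, g x ∂μ) (Icc 0 1) :=
    continuousOn_setIntegral_of_abs_le (h𝓕 w hw) hg hgw hA hAm
      (ContinuousOn.congr (by fun_prop) fun t ht => hint t ht w hw)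
  have hG0 : ∫ x in A 0, g x ∂μ = 0 := by
    simpa [hint 0 (by simp) w hw] using hgdom .empty (empty_subset (A 0))
  have hG1 : ∫ x in A 1, g x ∂μ = ∫ x in S, g x ∂μ := by
    refine (sub_eq_zero.1 (abs_nonpos_iff.1 ?_)).symm
    simpa only [hint 1 (by simp) w hw, one_mul, sub_self] using hgdom (hAm 1) (hAS 1)
  obtain ⟨t, ht, htG⟩ := exists_add_half_sub_eq_half hG hG0
  have htA : A t ⊆ A (t + 1 / 2) := hA (by linarith)
  refine ⟨A (t + 1 / 2) \ A t, sdiff_subset.trans (hAS _), (hAm _).diff (hAm _), ?_⟩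
  rintro f (rfl | hf)
  · rw [setIntegral_sdiff (hAm t) hg.integrableOn htA, htG, hG1]
  · rw [setIntegral_sdiff (hAm t) (h𝓕 f hf).integrableOn htA,
      hint t ⟨ht.1, by linarith [ht.2]⟩ f hf,
      hint (t + 1 / 2) ⟨by linarith [ht.1], by linarith [ht.2]⟩ f hf]
    ring

theorem NonAtomic.halvable_of_finite (hμ : NonAtomic μ) (h𝓕 : 𝓕.Finite)
    (hint : ∀ f ∈ 𝓕, Integrable f μ) : Halvable μ 𝓕 := by
  let w : T → ℝ := fun t => ∑ f ∈ h𝓕.toFinset, |f t|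
  have hw : Integrable w μ :=
    integrable_finsetSum _ fun f hf => (hint f (h𝓕.mem_toFinset.1 hf)).abs
  have hdom (f) (hf : f ∈ 𝓕) (t : T) : |f t| ≤ w t :=
    Finset.single_le_sum (f := fun f : T → ℝ => |f t|) (fun _ _ => abs_nonneg _)
      (h𝓕.mem_toFinset.2 hf)
  suffices h : ∀ 𝓖 ⊆ 𝓕, Halvable μ (𝓖 ∪ {w}) from fun S hS =>
    (h 𝓕 Subset.rfl S hS).imp fun B hB => ⟨hB.1, hB.2.1, fun f hf => hB.2.2 f (.inl hf)⟩
  intro 𝓖 h𝓖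
  induction 𝓖, h𝓕.subset h𝓖 using Set.Finite.induction_on with
  | empty =>
    rw [empty_union]
    exact hμ.halvable_singleton hw fun t => Finset.sum_nonneg fun _ _ => abs_nonneg _
  | @insert g 𝓖 _ _ ih =>
    obtain ⟨hg, h𝓖'⟩ := insert_subset_iff.1 h𝓖
    rw [insert_union]
    refine (ih h𝓖').insert ?_ (.inr rfl) (hint g hg) (hdom g hg)
    rintro f (hf | rfl)
    · exact hint f (h𝓖' hf)
    · exact hw

/-- Lyapunov's convexity theorem. -/
theorem NonAtomic.exists_setIntegral_eq_smul {V : Type*} [NormedAddCommGroup V] [NormedSpace ℝ V]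
    [FiniteDimensional ℝ V] (hμ : NonAtomic μ) {f : T → V} (hf : Integrable f μ)
    (hS : MeasurableSet S) {θ : ℝ} (hθ : θ ∈ Icc (0 : ℝ) 1) :
    ∃ A ⊆ S, MeasurableSet A ∧ ∫ t in A, f t ∂μ = θ • ∫ t in S, f t ∂μ := by
  let e := Module.finBasis ℝ V
  let coord (i) : V →L[ℝ] ℝ := LinearMap.toContinuousLinearMap (e.coord i)
  have hcoord (i) : Integrable (fun t => coord i (f t)) μ := (coord i).integrable_comp hf
  obtain ⟨A, -, hAm, hAS, hA⟩ := (hμ.halvable_of_finite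
    (finite_range fun i t => coord i (f t)) (forall_mem_range.2 hcoord)).exists_chain
      (forall_mem_range.2 hcoord) hS
  have := FiniteDimensional.complete ℝ V
  refine ⟨A θ, hAS θ, hAm θ, e.ext_elem fun i => ?_⟩
  have hi := hA θ hθ _ (mem_range_self i)
  rw [(coord i).integral_comp_comm hf.integrableOn,
    (coord i).integral_comp_comm hf.integrableOn, ← smul_eq_mul, ← map_smul] at hi
  exact hi

end Lyapunov

section Integrands

variable {T E : Type*} [MeasurableSpace T] {μ : Measure T}

theorem Caratheodory.measurable_comp [TopologicalSpace E] {φ : T → E → ℝ} (hφ : Caratheodory φ)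
    {u : T → E} (hu : StronglyMeasurable u) : Measurable fun t => φ t (u t) :=
  measurable_of_tendsto_metrizable
    (fun n => (hu.approx n).measurable_bind (fun x t => φ t x) hφ.1)
    (tendsto_pi_nhds.2 fun t => ((hφ.2 t).tendsto _).comp (hu.tendsto_approx t))

theorem Caratheodory.aemeasurable_comp [TopologicalSpace E] {φ : T → E → ℝ}
    (hφ : Caratheodory φ) {u : T → E} (hu : AEStronglyMeasurable u μ) :
    AEMeasurable (fun t => φ t (u t)) μ :=
  ⟨_, hφ.measurable_comp hu.stronglyMeasurable_mk, hu.ae_eq_mk.mono fun t ht => by simp only [ht]⟩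

variable [NormedAddCommGroup E] {p : ℝ≥0∞}

theorem Caratheodory.integrable_comp {φ : T → E → ℝ} (hφ : Caratheodory φ) (hp : p ≠ 0)
    (hp' : p ≠ ∞) {M : T → ℝ} (hM : Integrable M μ) {k : ℝ}
    (hgrowth : ∀ t x, |φ t x| ≤ M t + k * ‖x‖ ^ p.toReal) {u : T → E} (hu : MemLp u p μ) :
    Integrable (fun t => φ t (u t)) μ :=
  (hM.add ((hu.integrable_norm_rpow hp hp').const_mul k)).mono'
    (hφ.aemeasurable_comp hu.1).aestronglyMeasurable (ae_of_all _ fun t => hgrowth t (u t))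

variable [NormedSpace ℝ E] {X : Set (Lp E p μ)}

theorem Decomposable.exists_ae_eq (hX : Decomposable X) {u v : Lp E p μ} (hu : u ∈ X)
    (hv : v ∈ X) {A : Set T} (hA : MeasurableSet A) :
    ∃ w ∈ X, (∀ᵐ t ∂μ, t ∈ A → w t = u t) ∧ ∀ᵐ t ∂μ, t ∈ Aᶜ → w t = v t := by
  obtain ⟨w, hw, hwA⟩ := hX u hu v hv A hA
  refine ⟨w, hw, hwA.mono fun t ht htA => ?_, hwA.mono fun t ht htA => ?_⟩
  · simp [ht, htA]
  · simp [ht, notMem_of_mem_compl htA]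

/-- Integral functionals are additive over a splitting of `T`, so a patch of `u` and `v` along a
Lyapunov set for `F · u - F · v` realizes the convex combination. -/
theorem Decomposable.convex_image_integral (hX : Decomposable X) (hμ : NonAtomic μ)
    {V : Type*} [NormedAddCommGroup V] [NormedSpace ℝ V] [FiniteDimensional ℝ V]
    {F : T → E → V} (hF : ∀ u ∈ X, Integrable (fun t => F t (u t)) μ) :
    Convex ℝ ((fun u : Lp E p μ => ∫ t, F t (u t) ∂μ) '' X) := by
  rintro _ ⟨u, hu, rfl⟩ _ ⟨v, hv, rfl⟩ θ η hθ hη hθη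
  obtain ⟨A, -, hA, hAint⟩ := hμ.exists_setIntegral_eq_smul ((hF u hu).sub (hF v hv))
    MeasurableSet.univ (θ := θ) ⟨hθ, by linarith⟩
  obtain ⟨w, hw, hwu, hwv⟩ := hX.exists_ae_eq hu hv hA
  refine ⟨w, hw, ?_⟩
  simp only [Pi.sub_apply, setIntegral_univ] at hAint
  rw [integral_sub (hF u hu).integrableOn (hF v hv).integrableOn,
    integral_sub (hF u hu) (hF v hv), sub_eq_iff_eq_add] at hAint
  calc ∫ t, F t (w t) ∂μ
      = ∫ t in A, F t (w t) ∂μ + ∫ t in Aᶜ, F t (w t) ∂μ := (integral_add_compl hA (hF w hw)).symm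
    _ = ∫ t in A, F t (u t) ∂μ + ∫ t in Aᶜ, F t (v t) ∂μ := by
      rw [setIntegral_congr_ae hA (hwu.mono fun t ht htA => by rw [ht htA]),
        setIntegral_congr_ae hA.compl (hwv.mono fun t ht htA => by rw [ht htA])]
    _ = θ • (∫ t, F t (u t) ∂μ - ∫ t, F t (v t) ∂μ) + ∫ t, F t (v t) ∂μ := by
      rw [hAint, add_assoc, integral_add_compl hA (hF v hv)]
    _ = θ • ∫ t, F t (u t) ∂μ + η • ∫ t, F t (v t) ∂μ := by
      rw [eq_sub_of_add_eq' hθη]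
      module

end Integrands

section Separation

variable {W : Type*} [AddCommGroup W] [Module ℝ W] {K : Set W} {f g : W → ℝ}

/-- Otherwise some convex combination of `p` and `q` has `0 < f`, barely, and `g < 0`. -/
theorem mul_le_mul_of_forall_pos (hf : ConcaveOn ℝ K f) (hg : ConvexOn ℝ K g)
    (hfg : ∀ x ∈ K, 0 < f x → 0 ≤ g x) {p q : W} (hp : p ∈ K) (hp0 : 0 < f p) (hq : q ∈ K)
    (hq0 : f q ≤ 0) : f q * g p ≤ f p * g q := by
  by_contra! hlt
  obtain ⟨ε, hε, hεg⟩ := exists_pos_mul_lt (sub_pos.2 hlt) (g p)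
  have hx : 0 ≤ ε - f q := by linarith
  have hxy : 0 < (ε - f q) + f p := by linarith
  have hfz := (concaveOn_iff_div.1 hf).2 hp hq hx hp0.le hxy
  have hgz := (convexOn_iff_div.1 hg).2 hp hq hx hp0.le hxy
  simp only [smul_eq_mul, div_mul_eq_mul_div, ← add_div] at hfz hgz
  have hz := hf.1 hp hq (div_nonneg hx hxy.le) (div_nonneg hp0.le hxy.le)
    (by rw [← add_div, div_self hxy.ne'])
  have hfpos : 0 < ((ε - f q) * f p + f p * f q) / (ε - f q + f p) :=
    div_pos (by nlinarith) hxy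
  have hgnonneg := (hfg _ hz (hfpos.trans_le hfz)).trans hgz
  rw [le_div_iff₀ hxy] at hgnonneg
  linarith

/-- Every ratio `g / f` over `{f < 0}` lies below every such ratio over `{0 < f}`. -/
theorem exists_nonneg_mul_le_of_forall_pos (hf : ConcaveOn ℝ K f) (hg : ConvexOn ℝ K g)
    (hfg : ∀ x ∈ K, 0 < f x → 0 ≤ g x) (hpos : ∃ x ∈ K, 0 < f x) :
    ∃ κ, 0 ≤ κ ∧ ∀ x ∈ K, κ * f x ≤ g x := by
  obtain ⟨p, hp, hp0⟩ := hpos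
  obtain ⟨κ, hκl, hκu⟩ := exists_between_of_forall_le
    (s := insert 0 ((fun q => g q / f q) '' {q ∈ K | f q < 0}))
    (t := (fun p => g p / f p) '' {p ∈ K | 0 < f p}) (insert_nonempty _ _) ⟨_, p, ⟨hp, hp0⟩, rfl⟩
    (by
      rintro _ (rfl | ⟨q, ⟨hq, hq0⟩, rfl⟩) _ ⟨p, ⟨hp, hp0⟩, rfl⟩
      · exact div_nonneg (hfg p hp hp0) hp0.le
      · rw [div_le_iff_of_neg hq0, div_mul_eq_mul_div, div_le_iff₀ hp0]
        linarith [mul_le_mul_of_forall_pos hf hg hfg hp hp0 hq hq0.le])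
  refine ⟨κ, hκl (mem_insert _ _), fun q hq => ?_⟩
  rcases lt_trichotomy (f q) 0 with hq0 | hq0 | hq0
  · exact (div_le_iff_of_neg hq0).1 (hκl (.inr ⟨q, ⟨hq, hq0⟩, rfl⟩))
  · have := mul_le_mul_of_forall_pos hf hg hfg hp hp0 hq hq0.le
    rw [hq0, zero_mul] at this
    rw [hq0, mul_zero]
    exact nonneg_of_mul_nonneg_right this hp0
  · exact (le_div_iff₀ hq0).1 (hκu ⟨q, ⟨hq, hq0⟩, rfl⟩)

theorem forall_pos_or_forall_neg_of_isPreconnected {Z : Type*} [TopologicalSpace Z] {Q : Set Z}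
    (hQ : IsPreconnected Q) {h : Z → ℝ} (hh : ContinuousOn h Q) (hne : ∀ q ∈ Q, h q ≠ 0) :
    (∀ q ∈ Q, 0 < h q) ∨ ∀ q ∈ Q, h q < 0 := by
  by_contra! hcon
  obtain ⟨⟨p, hp, hp0⟩, q, hq, hq0⟩ := hcon
  obtain ⟨z, hz, hz0⟩ := hQ.intermediate_value₂ hp hq hh continuousOn_const hp0 hq0
  exact hne z hz hz0

theorem exists_slope_of_forall_pos_ne_zero {P : Set (ℝ × ℝ)} (hP : Convex ℝ P) {s : ℝ}
    (hs : ∀ q ∈ P, 0 < q.1 → s * q.1 + q.2 ≠ 0) :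
    (∀ q ∈ P, q.1 ≤ 0) ∨ (∃ κ ≤ s, ∀ q ∈ P, 0 ≤ κ * q.1 + q.2) ∨
      ∃ κ ≥ s, ∀ q ∈ P, κ * q.1 + q.2 ≤ 0 := by
  by_cases hpos : ∃ q ∈ P, 0 < q.1
  swap
  · push Not at hpos
    exact .inl hpos
  right
  let ℓ : ℝ × ℝ →ₗ[ℝ] ℝ := s • LinearMap.fst ℝ ℝ ℝ + LinearMap.snd ℝ ℝ ℝ
  have hfst : ConcaveOn ℝ P (LinearMap.fst ℝ ℝ ℝ) := (LinearMap.fst ℝ ℝ ℝ).concaveOn hP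
  have hconn : IsPreconnected {q ∈ P | 0 < q.1} := (hfst.convex_gt 0).isPreconnected
  rcases forall_pos_or_forall_neg_of_isPreconnected hconn (h := ℓ)
    ℓ.continuous_of_finiteDimensional.continuousOn (fun q hq => hs q hq.1 hq.2) with hsign | hsign
  · obtain ⟨κ, hκ, hle⟩ := exists_nonneg_mul_le_of_forall_pos hfst (ℓ.convexOn hP)
      (fun q hq hq0 => (hsign q ⟨hq, hq0⟩).le) hpos
    refine .inl ⟨s - κ, by linarith, fun q hq => ?_⟩
    have : κ * q.1 ≤ s * q.1 + q.2 := hle q hq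
    linarith
  · obtain ⟨κ, hκ, hle⟩ := exists_nonneg_mul_le_of_forall_pos hfst ((-ℓ).convexOn hP)
      (fun q hq hq0 => (neg_pos.2 (hsign q ⟨hq, hq0⟩)).le) hpos
    refine .inr ⟨s + κ, by linarith, fun q hq => ?_⟩
    have : κ * q.1 ≤ -(s * q.1 + q.2) := hle q hq
    linarith

end Separation

section Curve

variable {a b : ℝ} {γ : ℝ → ℝ}

/-- From `c`, slide along the line of slope `κ`, in the direction in which the pairing with `P`
increases, until the line meets the graph of `γ`. It does so because `c` lies on or below the chord
and `κ` compares with the slope `s` of the chord. -/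
theorem exists_graph_point_ge {P : Set (ℝ × ℝ)} (hP : Convex ℝ P)
    (hγ : ContinuousOn γ (Icc a b)) {s : ℝ} (hγb : γ b = γ a + s * (b - a))
    (hs : ∀ q ∈ P, 0 < q.1 → s * q.1 + q.2 ≠ 0) {c : ℝ × ℝ} (hc : c.1 ∈ Icc a b)
    (hγc : γ c.1 ≤ c.2) (hcs : c.2 ≤ γ a + s * (c.1 - a)) :
    ∃ l ∈ Icc a b, ∀ q ∈ P, c.2 * q.1 + c.1 * q.2 ≤ γ l * q.1 + l * q.2 := by
  have hline (κ : ℝ) : Continuous fun l => c.2 + κ * (l - c.1) := by fun_prop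
  rcases exists_slope_of_forall_pos_ne_zero hP hs with hneg | ⟨κ, hκ, hnonneg⟩ | ⟨κ, hκ, hnonpos⟩
  · exact ⟨c.1, hc, fun q hq => by linarith [mul_le_mul_of_nonpos_right hγc (hneg q hq)]⟩
  · obtain ⟨l, hl, hlκ⟩ := isPreconnected_Icc.intermediate_value₂
      (left_mem_Icc.2 hc.2) (right_mem_Icc.2 hc.2)
      (hγ.mono (Icc_subset_Icc_left hc.1)) (hline κ).continuousOn
      (by simpa using hγc) (by nlinarith [hc.2])
    refine ⟨l, ⟨hc.1.trans hl.1, hl.2⟩, fun q hq => ?_⟩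
    rw [hlκ]
    linarith [mul_nonneg (sub_nonneg.2 hl.1) (hnonneg q hq)]
  · obtain ⟨l, hl, hlκ⟩ := isPreconnected_Icc.intermediate_value₂
      (right_mem_Icc.2 hc.1) (left_mem_Icc.2 hc.1)
      (hγ.mono (Icc_subset_Icc_right hc.2)) (hline κ).continuousOn
      (by simpa using hγc) (by nlinarith [hc.1])
    refine ⟨l, ⟨hl.1, hl.2.trans hc.2⟩, fun q hq => ?_⟩
    rw [hlκ]
    linarith [mul_nonneg_of_nonpos_of_nonpos (sub_nonpos.2 hl.2) (hnonpos q hq)]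

theorem apply_eq_add_slope_mul (γ : ℝ → ℝ) (a b : ℝ) : γ b = γ a + slope γ a b * (b - a) := by
  have := sub_smul_slope γ a b
  rw [smul_eq_mul, vsub_eq_sub] at this
  linarith

theorem le_add_slope_mul_of_convexOn (hγ : ConvexOn ℝ (Icc a b) γ) {l : ℝ} (hl : l ∈ Icc a b) :
    γ l ≤ γ a + slope γ a b * (l - a) := by
  have hab : a ≤ b := hl.1.trans hl.2
  rw [← segment_eq_Icc hab, segment_eq_image] at hl
  obtain ⟨t, ht, rfl⟩ := hl
  calc γ ((1 - t) • a + t • b) ≤ (1 - t) • γ a + t • γ b :=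
        hγ.2 (left_mem_Icc.2 hab) (right_mem_Icc.2 hab) (sub_nonneg.2 ht.2) ht.1 (by ring)
    _ = γ a + slope γ a b * ((1 - t) • a + t • b - a) := by
        rw [apply_eq_add_slope_mul γ a b, smul_eq_mul, smul_eq_mul, smul_eq_mul, smul_eq_mul]
        ring

theorem mem_of_mem_closedConvexHull_graph (hγ : ContinuousOn γ (Icc a b))
    (hγc : ConvexOn ℝ (Icc a b) γ) {c : ℝ × ℝ}
    (hc : c ∈ closedConvexHull ℝ ((fun l => (l, γ l)) '' Icc a b)) :
    c.1 ∈ Icc a b ∧ γ c.1 ≤ c.2 ∧ c.2 ≤ γ a + slope γ a b * (c.1 - a) := by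
  have hepi : c ∈ {q : ℝ × ℝ | q.1 ∈ Icc a b ∧ γ q.1 ≤ q.2} :=
    closedConvexHull_min (by rintro _ ⟨l, hl, rfl⟩; exact ⟨hl, le_rfl⟩) hγc.convex_epigraph
      (isClosed_Icc.epigraph hγ) hc
  let ℓ : ℝ × ℝ →ₗ[ℝ] ℝ := LinearMap.snd ℝ ℝ ℝ - slope γ a b • LinearMap.fst ℝ ℝ ℝ
  have hchord : c ∈ {q : ℝ × ℝ | ℓ q ≤ γ a - slope γ a b * a} := by
    refine closedConvexHull_min ?_ (convex_halfSpace_le ℓ.isLinear _)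
      (isClosed_le ℓ.continuous_of_finiteDimensional continuous_const) hc
    rintro _ ⟨l, hl, rfl⟩
    have := le_add_slope_mul_of_convexOn hγc hl
    change γ l - slope γ a b * l ≤ _
    linarith
  have : c.2 - slope γ a b * c.1 ≤ γ a - slope γ a b * a := hchord
  exact ⟨hepi.1, hepi.2, by linarith⟩

end Curve

section Minimax

theorem isCompact_closedConvexHull {V : Type*} [AddCommGroup V] [Module ℝ V] [UniformSpace V]
    [IsUniformAddGroup V] [LocallyConvexSpace ℝ V] [ContinuousSMul ℝ V] [CompleteSpace V]
    {Γ : Set V} (hΓ : IsCompact Γ) : IsCompact (closedConvexHull ℝ Γ) := by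
  rw [closedConvexHull_eq_closure_convexHull]
  exact hΓ.totallyBounded.convexHull.closure.isCompact_of_isClosed isClosed_closure

variable {V W : Type*} [AddCommGroup V] [Module ℝ V] [AddCommGroup W] [Module ℝ W]
  [TopologicalSpace W] [IsTopologicalAddGroup W] [ContinuousSMul ℝ W] {K : Set W} {f : V → W → ℝ}

/-- Sion's minimax theorem, with values in `EReal` so that `K` may be empty or `f` unbounded. -/
theorem iSup_iInf_coe_eq_iInf_iSup_coe [TopologicalSpace V] [IsTopologicalAddGroup V]
    [ContinuousSMul ℝ V] {C : Set V} (hne : C.Nonempty) (hC : IsCompact C) (hCc : Convex ℝ C)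
    (hK : Convex ℝ K) (hf : ∀ w ∈ K, UpperSemicontinuousOn (fun v => f v w) C)
    (hfc : ∀ w ∈ K, QuasiconcaveOn ℝ C fun v => f v w)
    (hf' : ∀ v ∈ C, LowerSemicontinuousOn (f v) K) (hfc' : ∀ v ∈ C, QuasiconvexOn ℝ K (f v)) :
    ⨆ v ∈ C, ⨅ w ∈ K, (f v w : EReal) = ⨅ w ∈ K, ⨆ v ∈ C, (f v w : EReal) := by
  have hmono : Monotone Real.toEReal := EReal.coe_strictMono.monotone
  have hcont : Continuous Real.toEReal := continuous_coe_real_ereal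
  exact Sion.minimax' (β := ERealᵒᵈ) (f := fun v w => OrderDual.toDual (f v w : EReal)) hne hCc hC
    (fun w hw => hcont.comp_upperSemicontinuousOn (hf w hw) hmono)
    (fun w hw => ((hfc w hw).monotone_comp hmono).dual) hK
    (fun v hv => hcont.comp_lowerSemicontinuousOn (hf' v hv) hmono)
    (fun v hv => ((hfc' v hv).monotone_comp hmono).dual)

theorem iSup_iInf_coe_eq_iInf_iSup_coe_of_closedConvexHull [UniformSpace V] [IsUniformAddGroup V]
    [LocallyConvexSpace ℝ V] [ContinuousSMul ℝ V] [CompleteSpace V] {Γ : Set V}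
    (hne : Γ.Nonempty) (hΓ : IsCompact Γ) (hK : Convex ℝ K)
    (hf : ∀ w ∈ K, UpperSemicontinuousOn (fun v => f v w) (closedConvexHull ℝ Γ))
    (hfc : ∀ w ∈ K, QuasiconcaveOn ℝ (closedConvexHull ℝ Γ) fun v => f v w)
    (hf' : ∀ v ∈ closedConvexHull ℝ Γ, LowerSemicontinuousOn (f v) K)
    (hfc' : ∀ v ∈ closedConvexHull ℝ Γ, QuasiconvexOn ℝ K (f v))
    (hdom : ∀ c ∈ closedConvexHull ℝ Γ, ∃ v ∈ Γ, ∀ w ∈ K, f c w ≤ f v w) :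
    ⨆ v ∈ Γ, ⨅ w ∈ K, (f v w : EReal) = ⨅ w ∈ K, ⨆ v ∈ Γ, (f v w : EReal) := by
  apply le_antisymm
  · exact iSup₂_le fun v hv => iInf₂_mono fun w _ =>
      le_iSup₂ (f := fun v (_ : v ∈ Γ) => (f v w : EReal)) v hv
  calc ⨅ w ∈ K, ⨆ v ∈ Γ, (f v w : EReal)
      ≤ ⨅ w ∈ K, ⨆ c ∈ closedConvexHull ℝ Γ, (f c w : EReal) :=
        iInf₂_mono fun w _ => biSup_mono fun v hv => subset_closedConvexHull hv
    _ = ⨆ c ∈ closedConvexHull ℝ Γ, ⨅ w ∈ K, (f c w : EReal) :=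
        (iSup_iInf_coe_eq_iInf_iSup_coe (hne.mono subset_closedConvexHull)
          (isCompact_closedConvexHull hΓ) convex_closedConvexHull hK hf hfc hf' hfc').symm
    _ ≤ ⨆ v ∈ Γ, ⨅ w ∈ K, (f v w : EReal) := iSup₂_le fun c hc => by
        obtain ⟨v, hv, hle⟩ := hdom c hc
        exact (iInf₂_mono fun w hw => EReal.coe_le_coe_iff.2 (hle w hw)).trans
          (le_iSup₂ (f := fun v (_ : v ∈ Γ) => ⨅ w ∈ K, (f v w : EReal)) v hv)

theorem iSup_iInf_graph_eq_iInf_iSup_graph {a b : ℝ} (hab : a ≤ b) {γ : ℝ → ℝ}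
    (hγ : ContinuousOn γ (Icc a b)) (hγc : ConvexOn ℝ (Icc a b) γ) {K : Set (ℝ × ℝ × ℝ)}
    (hK : Convex ℝ K)
    (hends : ∀ q ∈ K, 0 < q.2.1 → γ a * q.2.1 + a * q.2.2 ≠ γ b * q.2.1 + b * q.2.2) :
    ⨆ l ∈ Icc a b, ⨅ q ∈ K, ((q.1 + γ l * q.2.1 + l * q.2.2 : ℝ) : EReal) =
      ⨅ q ∈ K, ⨆ l ∈ Icc a b, ((q.1 + γ l * q.2.1 + l * q.2.2 : ℝ) : EReal) := by
  let Γ := (fun l => (l, γ l)) '' Icc a b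
  let f (c : ℝ × ℝ) (q : ℝ × ℝ × ℝ) : ℝ := q.1 + c.2 * q.2.1 + c.1 * q.2.2
  have hΓ : IsCompact Γ := isCompact_Icc.image_of_continuousOn (continuousOn_id.prodMk hγ)
  have hne : Γ.Nonempty := (nonempty_Icc.2 hab).image _
  have hslope : ∀ q ∈ Prod.snd '' K, 0 < q.1 → slope γ a b * q.1 + q.2 ≠ 0 := by
    rintro _ ⟨q, hq, rfl⟩ hq0 h0
    refine hends q hq hq0 ?_
    linear_combination (a - b) * h0 - q.2.1 * apply_eq_add_slope_mul γ a b
  have hdom : ∀ c ∈ closedConvexHull ℝ Γ, ∃ v ∈ Γ, ∀ q ∈ K, f c q ≤ f v q := by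
    intro c hc
    obtain ⟨hcI, hγc, hcs⟩ := mem_of_mem_closedConvexHull_graph hγ hγc hc
    obtain ⟨l, hl, hle⟩ := exists_graph_point_ge (hK.linear_image (LinearMap.snd ℝ ℝ (ℝ × ℝ))) hγ
      (apply_eq_add_slope_mul γ a b) hslope hcI hγc hcs
    exact ⟨_, mem_image_of_mem _ hl, fun q hq => by
      linarith [hle q.2 (mem_image_of_mem _ hq)]⟩
  have hfst (q) : ConcaveOn ℝ (closedConvexHull ℝ Γ) fun c => f c q :=
    ⟨convex_closedConvexHull, fun c _ c' _ x y _ _ hxy => le_of_eq (by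
      simp only [f, Prod.fst_add, Prod.snd_add, Prod.smul_fst, Prod.smul_snd, smul_eq_mul]
      linear_combination q.1 * hxy)⟩
  have hsnd (c) : ConvexOn ℝ K (f c) :=
    ⟨hK, fun q _ q' _ x y _ _ _ => le_of_eq (by
      simp only [f, Prod.fst_add, Prod.snd_add, Prod.smul_fst, Prod.smul_snd, smul_eq_mul]
      ring)⟩
  simpa only [Γ, f, iSup_image] using iSup_iInf_coe_eq_iInf_iSup_coe_of_closedConvexHull (f := f)
    hne hΓ hK (fun q _ => Continuous.upperSemicontinuous (by fun_prop) |>.upperSemicontinuousOn _)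
    (fun q _ => (hfst q).quasiconcaveOn)
    (fun c _ => Continuous.lowerSemicontinuous (by fun_prop) |>.lowerSemicontinuousOn _)
    (fun c _ => (hsnd c).quasiconvexOn) hdom

end Minimax

section IntegralMinimax

variable {T E : Type*} [MeasurableSpace T] {μ : Measure T} [NormedAddCommGroup E]
  [NormedSpace ℝ E] {p : ℝ≥0∞} {X : Set (Lp E p μ)} {a b : ℝ} {γ : ℝ → ℝ} {φ ψ ω : T → E → ℝ}

theorem Decomposable.iSup_iInf_integral_eq_of_convexOn (hX : Decomposable X) (hμ : NonAtomic μ)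
    (hab : a ≤ b) (hγ : ContinuousOn γ (Icc a b)) (hγc : ConvexOn ℝ (Icc a b) γ)
    (hφ : ∀ u ∈ X, Integrable (fun t => φ t (u t)) μ)
    (hψ : ∀ u ∈ X, Integrable (fun t => ψ t (u t)) μ)
    (hω : ∀ u ∈ X, Integrable (fun t => ω t (u t)) μ)
    (hends : ∀ u ∈ X, 0 < (∫ t, ψ t (u t) ∂μ) →
      γ a * (∫ t, ψ t (u t) ∂μ) + a * (∫ t, ω t (u t) ∂μ) ≠
        γ b * (∫ t, ψ t (u t) ∂μ) + b * (∫ t, ω t (u t) ∂μ)) :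
    (⨆ l ∈ Icc a b, ⨅ u ∈ X,
        ((∫ t, (φ t (u t) + γ l * ψ t (u t) + l * ω t (u t)) ∂μ : ℝ) : EReal)) =
      ⨅ u ∈ X, ⨆ l ∈ Icc a b,
        ((∫ t, (φ t (u t) + γ l * ψ t (u t) + l * ω t (u t)) ∂μ : ℝ) : EReal) := by
  let F (t : T) (x : E) : ℝ × ℝ × ℝ := (φ t x, ψ t x, ω t x)
  have hF : ∀ u ∈ X, Integrable (fun t => F t (u t)) μ := fun u hu =>
    (hφ u hu).prodMk ((hψ u hu).prodMk (hω u hu))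
  have hFint : ∀ u ∈ X, ∫ t, F t (u t) ∂μ =
      (∫ t, φ t (u t) ∂μ, ∫ t, ψ t (u t) ∂μ, ∫ t, ω t (u t) ∂μ) := fun u hu => by
    rw [integral_pair (hφ u hu) ((hψ u hu).prodMk (hω u hu)), integral_pair (hψ u hu) (hω u hu)]
  have hsum : ∀ u ∈ X, ∀ l, ∫ t, (φ t (u t) + γ l * ψ t (u t) + l * ω t (u t)) ∂μ =
      (∫ t, F t (u t) ∂μ).1 + γ l * (∫ t, F t (u t) ∂μ).2.1 + l * (∫ t, F t (u t) ∂μ).2.2 := by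
    intro u hu l
    have hadd : Integrable (fun t => φ t (u t) + γ l * ψ t (u t)) μ :=
      (hφ u hu).add ((hψ u hu).const_mul _)
    rw [hFint u hu, integral_add hadd ((hω u hu).const_mul _),
      integral_add (hφ u hu) ((hψ u hu).const_mul _), integral_const_mul, integral_const_mul]
  have hminimax := iSup_iInf_graph_eq_iInf_iSup_graph hab hγ hγc (hX.convex_image_integral hμ hF)
    (forall_mem_image.2 fun u hu => by simpa only [hFint u hu] using hends u hu)
  simp only [iInf_image] at hminimax
  simpa +contextual only [hsum] using hminimax

theorem theorem6_general (hμ : NonAtomic μ) (hX : Decomposable X) (hab : a ≤ b)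
    (hγ : ContinuousOn γ (Icc a b))
    (hφ : ∀ u ∈ X, Integrable (fun t => φ t (u t)) μ)
    (hψ : ∀ u ∈ X, Integrable (fun t => ψ t (u t)) μ)
    (hω : ∀ u ∈ X, Integrable (fun t => ω t (u t)) μ)
    (hends :
      (ConvexOn ℝ (Icc a b) γ ∧
        ∀ u ∈ X, 0 < (∫ t, ψ t (u t) ∂μ) →
          γ a * (∫ t, ψ t (u t) ∂μ) + a * (∫ t, ω t (u t) ∂μ) ≠
            γ b * (∫ t, ψ t (u t) ∂μ) + b * (∫ t, ω t (u t) ∂μ)) ∨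
      (ConcaveOn ℝ (Icc a b) γ ∧
        ∀ u ∈ X, (∫ t, ψ t (u t) ∂μ) < 0 →
          γ a * (∫ t, ψ t (u t) ∂μ) + a * (∫ t, ω t (u t) ∂μ) ≠
            γ b * (∫ t, ψ t (u t) ∂μ) + b * (∫ t, ω t (u t) ∂μ))) :
    (⨆ l ∈ Icc a b, ⨅ u ∈ X,
        ((∫ t, (φ t (u t) + γ l * ψ t (u t) + l * ω t (u t)) ∂μ : ℝ) : EReal)) =
      ⨅ u ∈ X, ⨆ l ∈ Icc a b,
        ((∫ t, (φ t (u t) + γ l * ψ t (u t) + l * ω t (u t)) ∂μ : ℝ) : EReal) := by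
  rcases hends with ⟨hγc, hne⟩ | ⟨hγc, hne⟩
  · exact hX.iSup_iInf_integral_eq_of_convexOn hμ hab hγ hγc hφ hψ hω hne
  · have h := hX.iSup_iInf_integral_eq_of_convexOn hμ hab hγ.neg hγc.neg
      (ψ := fun t x => -ψ t x) hφ (fun u hu => (hψ u hu).neg) hω (by
        simpa only [integral_neg, Pi.neg_apply, neg_mul_neg, neg_pos] using hne)
    simpa only [Pi.neg_apply, neg_mul_neg] using h

end IntegralMinimax

theorem theorem6 {T E : Type*} [MeasurableSpace T] (μ : Measure T) [SigmaFinite μ]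
    (hμ : NonAtomic μ)
    [NormedAddCommGroup E] [NormedSpace ℝ E] [CompleteSpace E]
    (p : ℝ≥0∞) (hp : 1 ≤ p) (hp' : p ≠ ∞)
    (X : Set (Lp E p μ)) (hX : Decomposable X)
    (a b : ℝ) (hab : a ≤ b)
    (γ : ℝ → ℝ) (hγ : ContinuousOn γ (Icc a b))
    (φ ψ ω : T → E → ℝ)
    (hφ : Caratheodory φ) (hψ : Caratheodory ψ) (hω : Caratheodory ω)
    (M : T → ℝ) (hM : Integrable M μ) (k : ℝ)
    (hgrowth : ∀ (t : T) (x : E),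
      max (max |φ t x| |ψ t x|) |ω t x| ≤ M t + k * ‖x‖ ^ p.toReal)
    (hends :
      (ConvexOn ℝ (Icc a b) γ ∧
        ∀ u ∈ X, 0 < (∫ t, ψ t (u t) ∂μ) →
          γ a * (∫ t, ψ t (u t) ∂μ) + a * (∫ t, ω t (u t) ∂μ) ≠
            γ b * (∫ t, ψ t (u t) ∂μ) + b * (∫ t, ω t (u t) ∂μ)) ∨
      (ConcaveOn ℝ (Icc a b) γ ∧
        ∀ u ∈ X, (∫ t, ψ t (u t) ∂μ) < 0 →
          γ a * (∫ t, ψ t (u t) ∂μ) + a * (∫ t, ω t (u t) ∂μ) ≠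
            γ b * (∫ t, ψ t (u t) ∂μ) + b * (∫ t, ω t (u t) ∂μ))) :
    (⨆ l ∈ Icc a b, ⨅ u ∈ X,
        ((∫ t, (φ t (u t) + γ l * ψ t (u t) + l * ω t (u t)) ∂μ : ℝ) : EReal)) =
      ⨅ u ∈ X, ⨆ l ∈ Icc a b,
        ((∫ t, (φ t (u t) + γ l * ψ t (u t) + l * ω t (u t)) ∂μ : ℝ) : EReal) := by
  obtain ⟨⟨hφM, hψM⟩, hωM⟩ := by simpa only [max_le_iff, forall_and] using hgrowth
  have hp0 : p ≠ 0 := (zero_lt_one.trans_le hp).ne'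
  exact theorem6_general hμ hX hab hγ
    (fun u _ => hφ.integrable_comp hp0 hp' hM hφM (Lp.memLp u))
    (fun u _ => hψ.integrable_comp hp0 hp' hM hψM (Lp.memLp u))
    (fun u _ => hω.integrable_comp hp0 hp' hM hωM (Lp.memLp u)) hends
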